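/- Let $A\subseteq B(H)$ and $B\subseteq B(K)$ be von Neumann algebras acting on complex Hilbert spaces $H$ and $K$, and suppose that their commutants $A'\subseteq B(H)$ and $B'\subseteq B(K)$ are $*$-isomorphic. Then there is a nonzero cardinal $J$ such that $A\,\bar\otimes\,M_J$ and $B\,\bar\otimes\,M_J$ are unitarily equivalent, i.e. there is a unitary operator $U$ from $H\otimes\ell^2_J$ onto $K\otimes\ell^2_J$ with $$B\,\bar\otimes\,M_J=U\,(A\,\bar\otimes\,M_J)\,U^*.$$ Here $\ell^2_J$ is the Hilbert space of square-summable complex families indexed by a set of cardinality $J$, $M_J=B(\ell^2_J)$, $H\otimes\ell^2_J$ is the Hilbert space tensor product, and for $X\subseteq B(H)$, $X\,\bar\otimes\,M_J$ denotes the $w^*$-closed linear span in $B(H\otimes\ell^2_J)$ of the operators $x\otimes y$ with $x\in X$ and $y\in M_J$. -/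

import Mathlib

open scoped TensorProduct

universe u v

noncomputable section

/-- The Hilbert space tensor product of `H` and `L`: the completion of the algebraic tensor product
for the inner product with `⟪ξ ⊗ η, ξ' ⊗ η'⟫ = ⟪ξ, ξ'⟫ * ⟪η, η'⟫`. -/
abbrev HilbertTensor (H L : Type*)
    [NormedAddCommGroup H] [InnerProductSpace ℂ H]
    [NormedAddCommGroup L] [InnerProductSpace ℂ L] : Type _ :=
  UniformSpace.Completion (H ⊗[ℂ] L)

/-- The bounded operator `x ⊗ y` on the Hilbert space tensor product: the continuous extension of
the algebraic tensor product of the operators `x` and `y`. -/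
def opTensor {H L : Type*}
    [NormedAddCommGroup H] [InnerProductSpace ℂ H]
    [NormedAddCommGroup L] [InnerProductSpace ℂ L]
    (x : H →L[ℂ] H) (y : L →L[ℂ] L) : HilbertTensor H L →L[ℂ] HilbertTensor H L :=
  ((UniformSpace.Completion.toComplL (𝕜 := ℂ) (E := H ⊗[ℂ] L)).comp
    (TensorProduct.mapL x y)).extend UniformSpace.Completion.toComplL

theorem opTensor_coe {H L : Type*}
    [NormedAddCommGroup H] [InnerProductSpace ℂ H]
    [NormedAddCommGroup L] [InnerProductSpace ℂ L]
    (x : H →L[ℂ] H) (y : L →L[ℂ] L) (t : H ⊗[ℂ] L) :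
    opTensor x y (t : HilbertTensor H L) = ((TensorProduct.mapL x y t : H ⊗[ℂ] L) :
      HilbertTensor H L) :=
  ContinuousLinearMap.extend_eq (e := UniformSpace.Completion.toComplL (𝕜 := ℂ) (E := H ⊗[ℂ] L))
    _ UniformSpace.Completion.denseRange_coe
    (UniformSpace.Completion.isUniformInducing_coe (H ⊗[ℂ] L)) t

/-- The elementary formula `(x ⊗ y) (ξ ⊗ η) = x ξ ⊗ y η`. -/
theorem opTensor_tmul {H L : Type*}
    [NormedAddCommGroup H] [InnerProductSpace ℂ H]
    [NormedAddCommGroup L] [InnerProductSpace ℂ L]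
    (x : H →L[ℂ] H) (y : L →L[ℂ] L) (ξ : H) (η : L) :
    opTensor x y ((ξ ⊗ₜ[ℂ] η : H ⊗[ℂ] L) : HilbertTensor H L) =
      ((x ξ ⊗ₜ[ℂ] y η : H ⊗[ℂ] L) : HilbertTensor H L) :=
  opTensor_coe x y _

/-- The `w*`-topology (ultraweak topology) of `B(H)`: the coarsest topology for which all the
functionals `T ↦ ∑ₙ ⟪ξₙ, T ηₙ⟫`, with `∑ₙ ‖ξₙ‖² < ∞` and `∑ₙ ‖ηₙ‖² < ∞`, are continuous. These
functionals are precisely the elements of the predual (the trace class) of `B(H)`. -/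
abbrev weakStarTopology (H : Type*) [NormedAddCommGroup H] [InnerProductSpace ℂ H] :
    TopologicalSpace (H →L[ℂ] H) :=
  TopologicalSpace.induced
    (fun (T : H →L[ℂ] H) (p : lp (fun _ : ℕ => H) 2 × lp (fun _ : ℕ => H) 2) =>
      ∑' n, inner ℂ (p.1 n) (T (p.2 n)))
    Pi.topologicalSpace

/-- The normal spatial tensor product of `X ⊆ B(H)` and `Y ⊆ B(L)`: the `w*`-closed linear span in
`B(H ⊗ L)` of the operators `x ⊗ y` with `x ∈ X` and `y ∈ Y`. -/
def normalSpatialTensor {H L : Type*}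
    [NormedAddCommGroup H] [InnerProductSpace ℂ H]
    [NormedAddCommGroup L] [InnerProductSpace ℂ L]
    (X : Set (H →L[ℂ] H)) (Y : Set (L →L[ℂ] L)) :
    Set (HilbertTensor H L →L[ℂ] HilbertTensor H L) :=
  @closure _ (weakStarTopology (HilbertTensor H L))
    (Submodule.span ℂ {T | ∃ x ∈ X, ∃ y ∈ Y, T = opTensor x y})

/-- The Hilbert space `ℓ²_J` of square-summable complex families indexed by `J`. -/
abbrev EllTwo (J : Type*) : Type _ := lp (fun _ : J => ℂ) 2

/-- `M_J`, the `J × J` matrices whose finite submatrices are uniformly bounded, acting on `ℓ²_J`: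
that is, all of `B(ℓ²_J)`. -/
def matrixAlgebra (J : Type*) : Set (EllTwo J →L[ℂ] EllTwo J) := Set.univ

/-- Subsets `S ⊆ B(H)` and `T ⊆ B(K)` are unitarily equivalent if `T = U S U*` for some unitary
operator `U` from `H` onto `K`. -/
def UnitarilyEquivalent {H K : Type*}
    [NormedAddCommGroup H] [InnerProductSpace ℂ H]
    [NormedAddCommGroup K] [InnerProductSpace ℂ K]
    (S : Set (H →L[ℂ] H)) (T : Set (K →L[ℂ] K)) : Prop :=
  ∃ U : H ≃ₗᵢ[ℂ] K,
    T = (fun x : H →L[ℂ] H =>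
      (U : H →L[ℂ] K).comp (x.comp (U.symm : K →L[ℂ] H))) '' S

end

/-! Write M = A' and N = B', with isomorphism σ : M → N. By the commutation theorem
(`mem_normalSpatialTensor_matrixAlgebra_iff`), A ⊗̄ M_J is the commutant of the amplification A' ⊗
1, and likewise for B. It therefore suffices to find J and a unitary carrying x ⊗ 1 to σ(x) ⊗ 1 for
every x in M.

Regard K as a representation of M through σ. An isomorphism of von Neumann algebras preserves order,
hence suprema, hence is normal. Normality yields a Radon–Nikodym type domination between vector
functionals (`exists_norm_map_apply_le`), and so enough intertwiners K → H to separate the vectors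
of K. A maximal family of them satisfies ∑ Tᵢ* Tᵢ = 1 (`exists_family_intertwines`), and its column
is an isometric intertwiner of K into a multiple of H. If J absorbs the index set of the family,
this becomes an isometric intertwiner K ⊗ ℓ²_J → H ⊗ ℓ²_J. Symmetry gives one in the other
direction, and a Schröder–Bernstein argument (`exists_unitary_of_isometric_intertwiners`) turns the
two into a unitary. -/

open Filter Topology
open scoped InnerProduct ComplexOrder

/-! ### Schröder–Bernstein for isometric intertwiners -/

/-- The orthogonal projection onto a subspace that is invariant under an operator and its adjoint
commutes with the operator. -/
theorem starProjection_apply_comm {X : Type*} [NormedAddCommGroup X] [InnerProductSpace ℂ X]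
    [CompleteSpace X] (Q : Submodule ℂ X) [Q.HasOrthogonalProjection] (a : X →L[ℂ] X)
    (ha : ∀ x ∈ Q, a x ∈ Q) (ha' : ∀ x ∈ Q, (a†) x ∈ Q) (x : X) :
    Q.starProjection (a x) = a (Q.starProjection x) := by
  refine (Submodule.eq_starProjection_of_mem_of_inner_eq_zero
    (ha _ (Submodule.starProjection_apply_mem Q x)) fun y hy => ?_)
  rw [← map_sub, ← ContinuousLinearMap.adjoint_inner_right]
  exact Submodule.starProjection_inner_eq_zero x _ (ha' y hy)

/-- The Schröder–Bernstein theorem for representations: if each of two families of operators,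
indexed alike and closed under adjoints, is isometrically intertwined into the other one, then the
two families are unitarily equivalent. -/
theorem exists_unitary_of_isometric_intertwiners {X Y : Type*}
    [NormedAddCommGroup X] [InnerProductSpace ℂ X] [CompleteSpace X]
    [NormedAddCommGroup Y] [InnerProductSpace ℂ Y] [CompleteSpace Y]
    (R : Set ((X →L[ℂ] X) × (Y →L[ℂ] Y))) (hR : ∀ p ∈ R, (p.1†, p.2†) ∈ R)
    (V : X →ₗᵢ[ℂ] Y) (W : Y →ₗᵢ[ℂ] X)
    (hV : ∀ p ∈ R, ∀ x, V (p.1 x) = p.2 (V x)) (hW : ∀ p ∈ R, ∀ y, W (p.2 y) = p.1 (W y)) :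
    ∃ U : X ≃ₗᵢ[ℂ] Y, ∀ p ∈ R, ∀ x, U (p.1 x) = p.2 (U x) := by
  set v : X →L[ℂ] Y := V.toContinuousLinearMap with hv
  set w : Y →L[ℂ] X := W.toContinuousLinearMap with hw
  have vv : ∀ x, (v†) (v x) = x := fun x => by
    refine ext_inner_right ℂ fun y => ?_
    rw [ContinuousLinearMap.adjoint_inner_left]
    exact V.inner_map_map x y
  have ww : ∀ x, (w†) (w x) = x := fun x => by
    refine ext_inner_right ℂ fun y => ?_
    rw [ContinuousLinearMap.adjoint_inner_left]
    exact W.inner_map_map x y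
  have hv1 : ∀ p ∈ R, ∀ x, v (p.1 x) = p.2 (v x) := hV
  have hw1 : ∀ p ∈ R, ∀ x, w (p.2 x) = p.1 (w x) := hW
  have hv2 : ∀ p ∈ R, ∀ y, (v†) (p.2 y) = p.1 ((v†) y) := fun p hp y => by
    refine ext_inner_right ℂ fun x => ?_
    have := hv1 _ (hR p hp) x
    simp only at this
    rw [ContinuousLinearMap.adjoint_inner_left, ← ContinuousLinearMap.adjoint_inner_right p.2,
      ← this, ← ContinuousLinearMap.adjoint_inner_left v, ContinuousLinearMap.adjoint_inner_right]
  have hw2 : ∀ p ∈ R, ∀ y, (w†) (p.1 y) = p.2 ((w†) y) := fun p hp y => by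
    refine ext_inner_right ℂ fun x => ?_
    have := hw1 _ (hR p hp) x
    simp only at this
    rw [ContinuousLinearMap.adjoint_inner_left, ← ContinuousLinearMap.adjoint_inner_right p.1,
      ← this, ← ContinuousLinearMap.adjoint_inner_left w, ContinuousLinearMap.adjoint_inner_right]
  set d : X →L[ℂ] X := (v†) ∘L (w†) with hd
  set e : X →L[ℂ] X := 1 - w ∘L (w†) with he
  have hda : ∀ x, d x = (v†) ((w†) x) := fun x => rfl
  have hea : ∀ x, e x = x - w ((w†) x) := fun x => rfl
  -- Since d = (wv)* and e is the projection onto (wY)⊥, Q is the orthogonal complement of the sum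
  -- of all (wv)ⁿ (wY)⊥, as in the set-theoretic argument. The unitary will be v on Q⊥ and w* = w⁻¹
  -- on Q.
  let Q : Submodule ℂ X := ⨅ n : ℕ, (e ∘L d ^ n).ker
  have hQ : ∀ x, x ∈ Q ↔ ∀ n : ℕ, e ((d ^ n) x) = 0 := fun x => by
    simp only [Q, Submodule.mem_iInf]
    rfl
  have hQ' : ∀ x, x ∈ Q ↔ e x = 0 ∧ d x ∈ Q := fun x => by
    rw [hQ, hQ]
    constructor
    · intro h
      refine ⟨by simpa using h 0, fun n => ?_⟩
      simpa [pow_succ] using h (n + 1)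
    · rintro ⟨h0, h⟩ (_ | n)
      · simpa using h0
      · simpa [pow_succ] using h n
  have hQc : IsClosed (Q : Set X) := by
    rw [Submodule.coe_iInf]
    exact isClosed_iInter fun n => (e ∘L d ^ n).isClosed_ker
  have : CompleteSpace Q := hQc.completeSpace_coe
  set q : X →L[ℂ] X := Q.starProjection with hq
  have hqmem : ∀ x, q x ∈ Q := fun x => Submodule.starProjection_apply_mem Q x
  have e_inner : ∀ x y, inner ℂ (e x) y = inner ℂ x (e y) := fun x y => by
    rw [hea, hea, inner_sub_left, inner_sub_right, ← ContinuousLinearMap.adjoint_inner_right,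
      ContinuousLinearMap.adjoint_inner_left]
  -- Equivalently 1 - q = e + wv(1 - q)d, the projection form of Q⊥ = (wY)⊥ ⊕ wv Q⊥.
  have hqid : ∀ x, q x = w ((w†) x) - w (v (d x)) + w (v (q (d x))) := fun x => by
    refine Submodule.eq_starProjection_of_mem_of_inner_eq_zero ?_ fun y hy => ?_
    · rw [hQ']
      constructor
      · simp [hea, ww]
      · have : d (w ((w†) x) - w (v (d x)) + w (v (q (d x)))) = q (d x) := by
          simp [hda, ww, vv]
        rw [this]
        exact hqmem _
    · have h1 : x - (w ((w†) x) - w (v (d x)) + w (v (q (d x)))) =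
          e x + w (v (d x - q (d x))) := by
        rw [hea]; simp only [map_sub]; abel
      obtain ⟨hy1, hy2⟩ := (hQ' y).1 hy
      rw [h1, inner_add_left, e_inner, hy1, inner_zero_right, zero_add,
        ← ContinuousLinearMap.adjoint_inner_right, ← ContinuousLinearMap.adjoint_inner_right]
      exact Submodule.starProjection_inner_eq_zero _ _ hy2
  have hQR : ∀ p ∈ R, ∀ x ∈ Q, p.1 x ∈ Q := fun p hp x hx => by
    have hdp : ∀ x, d (p.1 x) = p.1 (d x) := fun x => by rw [hda, hw2 p hp, hv2 p hp, hda]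
    have hdn : ∀ n : ℕ, ∀ x, (d ^ n) (p.1 x) = p.1 ((d ^ n) x) := fun n => by
      induction n with
      | zero => simp
      | succ n ih => intro x; simp [pow_succ, hdp, ih]
    rw [hQ] at hx ⊢
    intro n
    rw [hdn, hea, hw2 p hp, hw1 p hp, ← map_sub, ← hea, hx n, map_zero]
  have hqR : ∀ p ∈ R, ∀ x, q (p.1 x) = p.1 (q x) := fun p hp x =>
    starProjection_apply_comm Q p.1 (hQR p hp) (hQR _ (hR p hp)) x
  have hqq : ∀ x ∈ Q, q x = x := fun x hx => Submodule.starProjection_eq_self_iff.2 hx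
  have hQw : ∀ x ∈ Q, w ((w†) x) = x := fun x hx => by
    have := ((hQ' x).1 hx).1
    rw [hea, sub_eq_zero] at this
    exact this.symm
  have hqwv : ∀ x, q (w (v x)) = w (v (q x)) := fun x => by
    rw [hqid (w (v x))]; simp [hda, ww, vv]
  let T : X →L[ℂ] Y := v ∘L (1 - q) + (w†) ∘L q
  have hT : ∀ x, T x = v (x - q x) + (w†) (q x) := fun x => rfl
  have hTn : ∀ x, ‖T x‖ = ‖x‖ := fun x => by
    -- The two pieces have orthogonal images because q commutes with wv and kills x - q x.
    have h1 : inner ℂ (v (x - q x)) ((w†) (q x)) = 0 := by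
      rw [ContinuousLinearMap.adjoint_inner_right]
      rw [← hqq (q x) (hqmem x), ← Submodule.inner_starProjection_left_eq_right Q, ← hq, hqwv]
      simp [hqq _ (hqmem x)]
    have h2 : ‖v (x - q x)‖ = ‖x - q x‖ := V.norm_map _
    have h3 : ‖(w†) (q x)‖ = ‖q x‖ := by
      rw [← W.norm_map]
      exact congrArg norm (hQw _ (hqmem x))
    have h4 : inner ℂ (x - q x) (q x) = 0 := Submodule.starProjection_inner_eq_zero x _ (hqmem x)
    have h5 := norm_add_sq_eq_norm_sq_add_norm_sq_of_inner_eq_zero _ _ h1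
    have h6 := norm_add_sq_eq_norm_sq_add_norm_sq_of_inner_eq_zero _ _ h4
    rw [sub_add_cancel] at h6
    rw [hT, ← sq_eq_sq₀ (norm_nonneg _) (norm_nonneg _)]
    rw [sq, sq, h5, h6, h2, h3]
  have hTs : Function.Surjective T := fun y => by
    refine ⟨(v†) y - q ((v†) y) + q (w y), ?_⟩
    have h1 : q (q (w y)) = q (w y) := hqq _ (hqmem _)
    have h2 : q (q ((v†) y)) = q ((v†) y) := hqq _ (hqmem _)
    have h3 := hqid (w y)
    rw [ww, hda, ww] at h3
    have h4 : (w†) (q (w y)) = y - v ((v†) y) + v (q ((v†) y)) := by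
      rw [h3]; simp [ww]
    rw [hT]
    simp only [map_add, map_sub, h1, h2, h4]
    abel
  refine ⟨LinearIsometryEquiv.ofSurjective ⟨T.toLinearMap, hTn⟩ hTs, fun p hp x => ?_⟩
  change T (p.1 x) = p.2 (T x)
  rw [hT, hT, hqR p hp, ← map_sub, hv1 p hp, hw2 p hp, map_add]

/-! ### Quadratic forms and weak operator limits -/

/-- The Loewner order on operators on a complex Hilbert space is the order of the quadratic
forms. -/
theorem ContinuousLinearMap.le_iff_inner_le {H : Type*} [NormedAddCommGroup H]
    [InnerProductSpace ℂ H] {a b : H →L[ℂ] H} :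
    a ≤ b ↔ ∀ x, inner ℂ x (a x) ≤ inner ℂ x (b x) := by
  rw [ContinuousLinearMap.le_def]
  constructor
  · intro h x
    simpa [inner_sub_right] using h.inner_nonneg_right x
  · intro h
    rw [ContinuousLinearMap.isPositive_iff_complex]
    intro x
    have h1 : 0 ≤ inner ℂ x ((b - a) x) := by simpa [inner_sub_right] using h x
    obtain ⟨h2, h3⟩ := Complex.nonneg_iff.1 h1
    rw [← inner_conj_symm]
    generalize inner ℂ x ((b - a) x) = z at h2 h3
    exact ⟨Complex.ext (by simp) (by simp [← h3]), by simpa using h2⟩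

/-- A bounded family of operators converges in the weak operator topology along every
ultrafilter. -/
theorem exists_tendsto_inner_of_norm_le {H ι : Type*} [NormedAddCommGroup H]
    [InnerProductSpace ℂ H] [CompleteSpace H] (l : Ultrafilter ι) (a : ι → H →L[ℂ] H) (C : ℝ)
    (ha : ∀ i, ‖a i‖ ≤ C) :
    ∃ s : H →L[ℂ] H, ∀ x y, Tendsto (fun i => inner ℂ x (a i y)) l (𝓝 (inner ℂ x (s y))) := by
  have hb : ∀ x y i, ‖inner ℂ x (a i y)‖ ≤ C * ‖x‖ * ‖y‖ := fun x y i => by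
    calc ‖inner ℂ x (a i y)‖ ≤ ‖x‖ * ‖a i y‖ := norm_inner_le_norm _ _
      _ ≤ ‖x‖ * (C * ‖y‖) := by gcongr; exact (a i).le_of_opNorm_le (ha i) y
      _ = _ := by ring
  have hex : ∀ x y, ∃ z : ℂ, Tendsto (fun i => inner ℂ x (a i y)) l (𝓝 z) := fun x y => by
    obtain ⟨z, -, hz⟩ := (isCompact_closedBall (0 : ℂ) (C * ‖x‖ * ‖y‖)).ultrafilter_le_nhds
      (l.map fun i => inner ℂ x (a i y)) (by
        rw [Filter.le_principal_iff]
        change ∀ᶠ i in l, inner ℂ x (a i y) ∈ Metric.closedBall (0 : ℂ) (C * ‖x‖ * ‖y‖)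
        exact Eventually.of_forall fun i => by simpa using hb x y i)
    exact ⟨z, hz⟩
  choose B hB using hex
  -- The pointwise limits form a bounded sesquilinear form, which the Riesz theorem represents by an
  -- operator.
  let B' : H →ₗ⋆[ℂ] H →ₗ[ℂ] ℂ := LinearMap.mk₂'ₛₗ _ _ B
    (fun x x' y => tendsto_nhds_unique (hB _ _) (by
      simpa [inner_add_left] using (hB x y).add (hB x' y)))
    (fun c x y => tendsto_nhds_unique (hB _ _) (by
      simpa [inner_smul_left, mul_comm] using (hB x y).const_mul ((starRingEnd ℂ) c)))
    (fun x y y' => tendsto_nhds_unique (hB _ _) (by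
      simpa [inner_add_right] using (hB x y).add (hB x y')))
    (fun c x y => tendsto_nhds_unique (hB _ _) (by
      simpa [inner_smul_right] using (hB x y).const_mul c))
  have hB' : ∀ x y, ‖B' x y‖ ≤ C * ‖x‖ * ‖y‖ := fun x y =>
    le_of_tendsto (hB x y).norm (Eventually.of_forall (hb x y))
  let B'' := B'.mkContinuous₂ C hB'
  refine ⟨(InnerProductSpace.continuousLinearMapOfBilin B'')†, fun x y => ?_⟩
  rw [ContinuousLinearMap.adjoint_inner_right,
    InnerProductSpace.continuousLinearMapOfBilin_apply]
  exact hB x y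

/-! ### Order and normality of isomorphisms -/

namespace VonNeumannAlgebra

variable {H : Type u} [NormedAddCommGroup H] [InnerProductSpace ℂ H] [CompleteSpace H]
  {K : Type v} [NormedAddCommGroup K] [InnerProductSpace ℂ K] [CompleteSpace K]

/-- The bicommutant property reduces membership to commutation relations, which pass to weak limits.
-/
theorem mem_of_forall_commutant {M : VonNeumannAlgebra H} {a : H →L[ℂ] H}
    (h : ∀ g ∈ M.commutant, ∀ x, g (a x) = a (g x)) : a ∈ M := by
  rw [← M.commutant_commutant, mem_commutant_iff]
  exact fun g hg => ContinuousLinearMap.ext (h g hg)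

/-- Whatever commutes with `a` commutes with its functional calculus, so the bicommutant property
applies. Square roots let positivity in `M` be expressed algebraically. -/
theorem sqrt_mem {M : VonNeumannAlgebra H} {a : H →L[ℂ] H} (ha : a ∈ M) : CFC.sqrt a ∈ M := by
  rw [← M.commutant_commutant, mem_commutant_iff]
  intro g hg
  have : Commute a g := mem_commutant_iff.1 hg a ha
  exact (this.cfcₙ_nnreal _).symm

/-- An isomorphism of von Neumann algebras preserves positivity. -/
theorem map_nonneg {M : VonNeumannAlgebra H} {N : VonNeumannAlgebra K}
    (σ : M.toStarSubalgebra ≃⋆ₐ[ℂ] N.toStarSubalgebra) {a : M.toStarSubalgebra}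
    (ha : (0 : H →L[ℂ] H) ≤ a) : (0 : K →L[ℂ] K) ≤ σ a := by
  let r : M.toStarSubalgebra := ⟨CFC.sqrt (a : H →L[ℂ] H), sqrt_mem a.2⟩
  have hr : star r * r = a := Subtype.ext <| by
    change star (CFC.sqrt (a : H →L[ℂ] H)) * CFC.sqrt (a : H →L[ℂ] H) = a
    rw [(CFC.sqrt_nonneg (a : H →L[ℂ] H)).isSelfAdjoint.star_eq, CFC.sqrt_mul_sqrt_self _ ha]
  rw [← hr, map_mul, map_star]
  exact star_mul_self_nonneg (σ r : K →L[ℂ] K)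

/-- An isomorphism of von Neumann algebras is monotone. -/
theorem map_le_map {M : VonNeumannAlgebra H} {N : VonNeumannAlgebra K}
    (σ : M.toStarSubalgebra ≃⋆ₐ[ℂ] N.toStarSubalgebra) {a b : M.toStarSubalgebra}
    (h : (a : H →L[ℂ] H) ≤ b) : (σ a : K →L[ℂ] K) ≤ σ b := by
  have : (0 : K →L[ℂ] K) ≤ σ (b - a) := map_nonneg σ (sub_nonneg.2 h)
  rw [map_sub] at this
  exact sub_nonneg.1 this

/-- A family in the positive part of the unit ball of a von Neumann algebra that increases along an
ultrafilter converges to its least upper bound in the weak operator topology. -/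
theorem exists_tendsto_of_eventually_le {ι : Type*} (M : VonNeumannAlgebra H) (l : Ultrafilter ι)
    (a : ι → H →L[ℂ] H) (haM : ∀ i, a i ∈ M) (h0 : ∀ i, 0 ≤ a i) (h1 : ∀ i, a i ≤ 1)
    (hl : ∀ i, ∀ᶠ j in l, a i ≤ a j) :
    ∃ s ∈ M, (∀ i, a i ≤ s) ∧ (∀ t, (∀ i, a i ≤ t) → s ≤ t) ∧
      ∀ x y, Tendsto (fun i => inner ℂ x (a i y)) l (𝓝 (inner ℂ x (s y))) := by
  obtain ⟨s, hs⟩ := exists_tendsto_inner_of_norm_le l a 1 fun i =>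
    (CStarAlgebra.norm_le_one_iff_of_nonneg (a i) (h0 i)).2 (h1 i)
  refine ⟨s, mem_of_forall_commutant fun g hg x => ?_, fun i => ?_, fun t ht => ?_, hs⟩
  · refine ext_inner_left ℂ fun y => ?_
    rw [← ContinuousLinearMap.adjoint_inner_left]
    refine tendsto_nhds_unique (hs _ _) ((hs y (g x)).congr fun i => ?_)
    rw [ContinuousLinearMap.adjoint_inner_left]
    congr 1
    exact congrArg (fun T : H →L[ℂ] H => T x) (mem_commutant_iff.1 hg _ (haM i))
  · rw [ContinuousLinearMap.le_iff_inner_le]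
    exact fun x => ge_of_tendsto (hs x x) ((hl i).mono fun j hj =>
      ContinuousLinearMap.le_iff_inner_le.1 hj x)
  · rw [ContinuousLinearMap.le_iff_inner_le]
    exact fun x => le_of_tendsto (hs x x) (Eventually.of_forall fun j =>
      ContinuousLinearMap.le_iff_inner_le.1 (ht j) x)

/-- Isomorphisms of von Neumann algebras are normal: they are compatible with weak limits of
increasing families. -/
theorem exists_tendsto_map_of_eventually_le {ι : Type*} {M : VonNeumannAlgebra H}
    {N : VonNeumannAlgebra K} (σ : M.toStarSubalgebra ≃⋆ₐ[ℂ] N.toStarSubalgebra)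
    (l : Ultrafilter ι) (a : ι → M.toStarSubalgebra)
    (h0 : ∀ i, (0 : H →L[ℂ] H) ≤ a i) (h1 : ∀ i, (a i : H →L[ℂ] H) ≤ 1)
    (hl : ∀ i, ∀ᶠ j in l, (a i : H →L[ℂ] H) ≤ a j) :
    ∃ s : M.toStarSubalgebra, (∀ i, (a i : H →L[ℂ] H) ≤ s) ∧
      (∀ t, (∀ i, (a i : H →L[ℂ] H) ≤ t) → (s : H →L[ℂ] H) ≤ t) ∧
      (∀ x y, Tendsto (fun i => inner ℂ x ((a i : H →L[ℂ] H) y)) l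
        (𝓝 (inner ℂ x ((s : H →L[ℂ] H) y)))) ∧
      ∀ x y, Tendsto (fun i => inner ℂ x ((σ (a i) : K →L[ℂ] K) y)) l
        (𝓝 (inner ℂ x ((σ s : K →L[ℂ] K) y))) := by
  obtain ⟨s, hsM, hs1, hs2, hs3⟩ :=
    exists_tendsto_of_eventually_le M l (fun i => (a i : H →L[ℂ] H)) (fun i => (a i).2) h0 h1 hl
  obtain ⟨s', hsN, hs1', hs2', hs3'⟩ :=
    exists_tendsto_of_eventually_le N l (fun i => (σ (a i) : K →L[ℂ] K)) (fun i => (σ (a i)).2)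
      (fun i => map_nonneg σ (h0 i))
      (fun i => by simpa using map_le_map σ (a := a i) (b := 1) (h1 i))
      (fun i => (hl i).mono fun j hj => map_le_map σ hj)
  -- Both σ and σ⁻¹ are monotone, so σ carries the least upper bound to the least upper bound; on
  -- each side that bound is the weak limit.
  have key : (σ ⟨s, hsM⟩ : K →L[ℂ] K) = s' := by
    refine le_antisymm ?_ (hs2' _ fun i => map_le_map σ (hs1 i))
    have : s ≤ (σ.symm ⟨s', hsN⟩ : H →L[ℂ] H) := hs2 _ fun i => by
      simpa using map_le_map σ.symm (a := σ (a i)) (b := ⟨s', hsN⟩) (hs1' i)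
    simpa using map_le_map σ (a := ⟨s, hsM⟩) this
  exact ⟨⟨s, hsM⟩, hs1, hs2, hs3, by rw [key]; exact hs3'⟩

/-! ### Cyclic subspaces and nonzero intertwiners -/

/-- The orbit map of a vector under a von Neumann algebra. -/
noncomputable def orbitMap (M : VonNeumannAlgebra H) (ζ : H) : M.toStarSubalgebra →ₗ[ℂ] H where
  toFun x := (x : H →L[ℂ] H) ζ
  map_add' _ _ := rfl
  map_smul' _ _ := rfl

/-- The closed cyclic subspace generated by a vector. -/
noncomputable def cyclicSubspace (M : VonNeumannAlgebra H) (ζ : H) : Submodule ℂ H :=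
  (LinearMap.range (M.orbitMap ζ)).topologicalClosure

instance (M : VonNeumannAlgebra H) (ζ : H) : CompleteSpace (M.cyclicSubspace ζ) :=
  (Submodule.isClosed_topologicalClosure _).completeSpace_coe

theorem apply_mem_cyclicSubspace (M : VonNeumannAlgebra H) (ζ : H) (x : M.toStarSubalgebra) :
    (x : H →L[ℂ] H) ζ ∈ M.cyclicSubspace ζ :=
  Submodule.le_topologicalClosure _ ⟨x, rfl⟩

theorem self_mem_cyclicSubspace (M : VonNeumannAlgebra H) (ζ : H) : ζ ∈ M.cyclicSubspace ζ :=
  M.apply_mem_cyclicSubspace ζ 1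

theorem cyclicSubspace_le {M : VonNeumannAlgebra H} {ζ : H} {p : Submodule ℂ H}
    (hp : IsClosed (p : Set H)) (h : ∀ x : M.toStarSubalgebra, (x : H →L[ℂ] H) ζ ∈ p) :
    M.cyclicSubspace ζ ≤ p :=
  Submodule.topologicalClosure_minimal _ (by rintro _ ⟨x, rfl⟩; exact h x) hp

theorem map_mem_cyclicSubspace {M : VonNeumannAlgebra H} {ζ : H} {x : H →L[ℂ] H} (hx : x ∈ M)
    {k : H} (hk : k ∈ M.cyclicSubspace ζ) : x k ∈ M.cyclicSubspace ζ := by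
  have : M.cyclicSubspace ζ ≤ (M.cyclicSubspace ζ).comap x.toLinearMap :=
    cyclicSubspace_le ((Submodule.isClosed_topologicalClosure _).preimage x.continuous)
      fun y => M.apply_mem_cyclicSubspace ζ ((⟨x, hx⟩ : M.toStarSubalgebra) * y)
  exact this hk

theorem starProjection_cyclicSubspace_comm {M : VonNeumannAlgebra H} {ζ : H} {x : H →L[ℂ] H}
    (hx : x ∈ M) (k : H) :
    (M.cyclicSubspace ζ).starProjection (x k) = x ((M.cyclicSubspace ζ).starProjection k) :=
  starProjection_apply_comm _ x (fun _ => map_mem_cyclicSubspace hx)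
    (fun _ => map_mem_cyclicSubspace (star_mem hx)) k

/-- If the orbit of `ζ` dominates the orbit of `θ`, some intertwiner sends `ζ` to `θ`. -/
theorem exists_intertwiner_of_norm_le {M : VonNeumannAlgebra H} {N : VonNeumannAlgebra K}
    (σ : M.toStarSubalgebra ≃⋆ₐ[ℂ] N.toStarSubalgebra) {ζ : H} {θ : K}
    (h : ∀ x : M.toStarSubalgebra, ‖(σ x : K →L[ℂ] K) θ‖ ≤ ‖(x : H →L[ℂ] H) ζ‖) :
    ∃ S : H →L[ℂ] K, (∀ (x : M.toStarSubalgebra) y, S ((x : H →L[ℂ] H) y) = (σ x : K →L[ℂ] K) (S y)) ∧ S ζ = θ := by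
  set Q := M.cyclicSubspace ζ
  let e : M.toStarSubalgebra →ₗ[ℂ] Q :=
    (M.orbitMap ζ).codRestrict Q (M.apply_mem_cyclicSubspace ζ)
  let f : M.toStarSubalgebra →ₗ[ℂ] K :=
    { toFun := fun x => (σ x : K →L[ℂ] K) θ
      map_add' := fun x y => by simp
      map_smul' := fun c x => by simp }
  have he : DenseRange e := by
    intro y
    rw [Topology.IsInducing.subtypeVal.closure_eq_preimage_closure_image, ← Set.range_comp]
    exact y.2
  have hfe : ∃ C, ∀ x, ‖f x‖ ≤ C * ‖e x‖ := ⟨1, fun x => by rw [one_mul]; exact h x⟩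
  -- The assignment xζ ↦ σ(x)θ is a well-defined contraction on the orbit and extends to the cyclic
  -- subspace. Composing with the projection, which commutes with `M`, sets it to zero on the
  -- complement.
  let S := f.extendOfNorm e
  have hS : ∀ x, S (e x) = f x := LinearMap.extendOfNorm_eq he hfe
  have hSx : ∀ x : M.toStarSubalgebra, ∀ y : Q,
      S ⟨(x : H →L[ℂ] H) y, map_mem_cyclicSubspace x.2 y.2⟩ = (σ x : K →L[ℂ] K) (S y) := by
    intro x y
    refine he.induction_on (p := fun y : Q =>
      S ⟨(x : H →L[ℂ] H) y, map_mem_cyclicSubspace x.2 y.2⟩ = (σ x : K →L[ℂ] K) (S y)) y ?_ ?_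
    · refine isClosed_eq (S.continuous.comp (Continuous.subtype_mk ?_ _)) (by fun_prop)
      fun_prop
    · intro a
      rw [hS]
      exact (hS (x * a)).trans (by simp [f])
  refine ⟨S ∘L Q.orthogonalProjectionOnto, fun x y => ?_, ?_⟩
  · rw [ContinuousLinearMap.comp_apply, ContinuousLinearMap.comp_apply, ← hSx]
    congr 1
    exact Subtype.ext (starProjection_cyclicSubspace_comm x.2 y)
  · have h1 : Q.orthogonalProjectionOnto ζ = e 1 := Subtype.ext
      (Submodule.starProjection_eq_self_iff.2 (M.self_mem_cyclicSubspace ζ))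
    rw [ContinuousLinearMap.comp_apply, h1, hS]
    simp [f]

/-- The projection onto the cyclic subspace of the commutant belongs to the algebra. -/
theorem starProjection_cyclicSubspace_commutant_mem (N : VonNeumannAlgebra K) (η : K) :
    (N.commutant.cyclicSubspace η).starProjection ∈ N :=
  mem_of_forall_commutant fun _ hg x => (starProjection_cyclicSubspace_comm hg x).symm

/-- A Radon–Nikodym type theorem: after cutting down by a self-adjoint element, a vector functional
on `N` is dominated by a vector functional on the isomorphic algebra `M`. -/
theorem exists_norm_map_apply_le {M : VonNeumannAlgebra H} {N : VonNeumannAlgebra K}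
    (σ : M.toStarSubalgebra ≃⋆ₐ[ℂ] N.toStarSubalgebra) {η : K} (hη : η ≠ 0) :
    ∃ (r : M.toStarSubalgebra) (ξ : H), star r = r ∧ (σ r : K →L[ℂ] K) η ≠ 0 ∧
      ∀ x : M.toStarSubalgebra, ‖(σ x : K →L[ℂ] K) ((σ r : K →L[ℂ] K) η)‖ ≤
        ‖(x : H →L[ℂ] H) ((r : H →L[ℂ] H) ξ)‖ := by
  set F := N.commutant.cyclicSubspace η with hF
  let f : N.toStarSubalgebra := ⟨F.starProjection, N.starProjection_cyclicSubspace_commutant_mem η⟩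
  have hfη : (f : K →L[ℂ] K) η = η :=
    Submodule.starProjection_eq_self_iff.2 (N.commutant.self_mem_cyclicSubspace η)
  have hff : f * f = f := Subtype.ext (Submodule.isIdempotentElem_starProjection F)
  -- `f` is the support of the vector functional of η on `N`: the kernel of y is invariant under N',
  -- so it contains F once it contains η.
  have hsupp : ∀ y : N.toStarSubalgebra, (y : K →L[ℂ] K) η = 0 → y * f = 0 := fun y hy => by
    have : F ≤ (y : K →L[ℂ] K).ker := cyclicSubspace_le (y : K →L[ℂ] K).isClosed_ker fun g => by
      have : (y : K →L[ℂ] K) * g = g * y := mem_commutant_iff.1 g.2 y y.2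
      change ((y : K →L[ℂ] K) * g) η = 0
      rw [this]
      change (g : K →L[ℂ] K) ((y : K →L[ℂ] K) η) = 0
      rw [hy, map_zero]
    exact Subtype.ext (ContinuousLinearMap.ext fun k =>
      this (Submodule.starProjection_apply_mem F k))
  clear_value f
  obtain ⟨e, rfl⟩ : ∃ e, f = σ e := ⟨σ.symm f, by simp⟩
  have hee : e * e = e := (EquivLike.injective σ) (by rw [map_mul, hff])
  have he0 : (e : H →L[ℂ] H) ≠ 0 := fun h => hη <| by
    have : e = 0 := Subtype.ext h
    rw [← hfη, this, map_zero]
    rfl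
  -- The vector ξ is taken in the range of e = σ⁻¹(f) and longer than η, so that the maximal element
  -- below cannot fix ξ.
  obtain ⟨ξ, hξe, hξn⟩ : ∃ ξ, (e : H →L[ℂ] H) ξ = ξ ∧ ‖η‖ < ‖ξ‖ := by
    obtain ⟨ξ, hξ⟩ : ∃ ξ, (e : H →L[ℂ] H) ξ ≠ 0 := by
      by_contra! h
      exact he0 (ContinuousLinearMap.ext h)
    have hn : 0 < ‖(e : H →L[ℂ] H) ξ‖ := norm_pos_iff.2 hξ
    refine ⟨(((‖η‖ + 1) / ‖(e : H →L[ℂ] H) ξ‖ : ℝ) : ℂ) • (e : H →L[ℂ] H) ξ, ?_, ?_⟩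
    · rw [map_smul]
      congr 1
      exact congrArg (fun T : M.toStarSubalgebra => (T : H →L[ℂ] H) ξ) hee
    · rw [norm_smul, Complex.norm_real, Real.norm_of_nonneg (by positivity),
        div_mul_cancel₀ _ hn.ne']
      linarith
  -- As in a Hahn decomposition, exhaust by elements on which the functional of ξ is at most that of
  -- η; on what remains beyond a maximal one, the functional of ξ must dominate.
  let S : Set (H →L[ℂ] H) := {a | ∃ h : a ∈ M, 0 ≤ a ∧ a ≤ 1 ∧
    (inner ℂ ξ (a ξ)).re ≤ (inner ℂ η ((σ ⟨a, h⟩ : K →L[ℂ] K) η)).re}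
  obtain ⟨a, ha⟩ : ∃ a, Maximal (· ∈ S) a := by
    refine zorn_le₀ S fun c hcS hc => ?_
    rcases c.eq_empty_or_nonempty with rfl | hne
    · refine ⟨0, ⟨zero_mem M, le_rfl, zero_le_one, ?_⟩, by simp⟩
      have : (⟨0, zero_mem M⟩ : M.toStarSubalgebra) = 0 := rfl
      rw [this]
      simp
    · have : Nonempty c := hne.to_subtype
      have : IsDirected c (· ≤ ·) := ⟨hc.directedOn.directed_val⟩
      -- The supremum of a chain is its weak limit, and normality of σ carries the defining
      -- inequality to the limit.
      obtain ⟨s, hs1, hs2, hs3, hs4⟩ := exists_tendsto_map_of_eventually_le σ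
        (Ultrafilter.of (atTop : Filter c)) (fun i => ⟨i, (hcS i.2).1⟩)
        (fun i => (hcS i.2).2.1) (fun i => (hcS i.2).2.2.1)
        (fun i => Ultrafilter.of_le _ (eventually_ge_atTop i))
      obtain ⟨a₀, ha₀⟩ := hne
      refine ⟨s, ⟨s.2, (hcS ha₀).2.1.trans (hs1 ⟨a₀, ha₀⟩), hs2 _ fun i => (hcS i.2).2.2.1, ?_⟩,
        fun z hz => hs1 ⟨z, hz⟩⟩
      exact le_of_tendsto_of_tendsto ((Complex.continuous_re.tendsto _).comp (hs3 ξ ξ))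
        ((Complex.continuous_re.tendsto _).comp (hs4 η η))
        (Eventually.of_forall fun i => (hcS i.2).2.2.2)
  obtain ⟨⟨haM, ha0, ha1, haξ⟩, hmax⟩ := ha
  have hq0 : (0 : H →L[ℂ] H) ≤ 1 - a := sub_nonneg.2 ha1
  have hqM : 1 - a ∈ M := sub_mem (one_mem M) haM
  let r : M.toStarSubalgebra := ⟨CFC.sqrt (1 - a), sqrt_mem hqM⟩
  have hrr : (r : H →L[ℂ] H) * r = 1 - a := CFC.sqrt_mul_sqrt_self _ hq0
  have hrs : star (r : H →L[ℂ] H) = r := (CFC.sqrt_nonneg (1 - a)).isSelfAdjoint.star_eq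
  refine ⟨r, ξ, Subtype.ext hrs, fun hr => ?_, fun x => ?_⟩
  -- If σ(r)η = 0, then rξ = 0 and aξ = ξ, whence ‖ξ‖² ≤ ⟪η, σ(a)η⟫ ≤ ‖η‖², against the choice of ξ.
  · have h1 : r * e = 0 := (EquivLike.injective σ) (by rw [map_mul, hsupp _ hr, map_zero])
    have h2 : (r : H →L[ℂ] H) ξ = 0 := by
      rw [← hξe]
      exact congrArg (fun T : M.toStarSubalgebra => (T : H →L[ℂ] H) ξ) h1
    have h3 : a ξ = ξ := by
      have : ((r : H →L[ℂ] H) * r) ξ = 0 := by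
        rw [mul_apply_eq_comp, h2, map_zero]
      rw [hrr] at this
      exact (sub_eq_zero.1 this).symm
    have h4 : (σ ⟨a, haM⟩ : K →L[ℂ] K) ≤ 1 := by
      simpa using map_le_map σ (a := ⟨a, haM⟩) (b := 1) ha1
    have h5 := (Complex.le_def.1 (ContinuousLinearMap.le_iff_inner_le.1 h4 η)).1
    have h6 := haξ.trans h5
    rw [h3, one_apply_eq_self] at h6
    have h7 : ‖ξ‖ ^ 2 ≤ ‖η‖ ^ 2 := by
      rw [← inner_self_eq_norm_sq (𝕜 := ℂ) ξ, ← inner_self_eq_norm_sq (𝕜 := ℂ) η]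
      exact h6
    exact absurd (le_of_sq_le_sq h7 (norm_nonneg η)) (not_le.2 hξn)
  · by_contra! hlt
    let y := x * r
    -- With y = xr one has y*y ≤ ‖x‖² r² ≤ C(1 - a), so b = C⁻¹ y*y can be added to `a` without
    -- exceeding 1; the summand 1 keeps C positive. Maximality then forces y = 0.
    let C : ℝ := ‖(x : H →L[ℂ] H)‖ ^ 2 + 1
    have hC : 0 < C := by positivity
    let b : M.toStarSubalgebra := ((C⁻¹ : ℝ) : ℂ) • (star y * y)
    have hb : ∀ ζ, inner ℂ ζ ((b : H →L[ℂ] H) ζ) =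
        ((C⁻¹ * ‖(y : H →L[ℂ] H) ζ‖ ^ 2 : ℝ) : ℂ) := fun ζ => by
      change inner ℂ ζ (((C⁻¹ : ℝ) : ℂ) • ((y : H →L[ℂ] H)†) ((y : H →L[ℂ] H) ζ)) = _
      rw [inner_smul_right, ContinuousLinearMap.adjoint_inner_right, inner_self_eq_norm_sq_to_K]
      push_cast
      rfl
    have hσb : ∀ ζ, inner ℂ ζ ((σ b : K →L[ℂ] K) ζ) =
        ((C⁻¹ * ‖(σ y : K →L[ℂ] K) ζ‖ ^ 2 : ℝ) : ℂ) := fun ζ => by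
      have : σ b = ((C⁻¹ : ℝ) : ℂ) • (star (σ y) * σ y) := by
        simp only [b, map_smul, map_mul, map_star]
      rw [this]
      change inner ℂ ζ (((C⁻¹ : ℝ) : ℂ) • ((σ y : K →L[ℂ] K)†) ((σ y : K →L[ℂ] K) ζ)) = _
      rw [inner_smul_right, ContinuousLinearMap.adjoint_inner_right, inner_self_eq_norm_sq_to_K]
      push_cast
      rfl
    have hq : ∀ ζ, inner ℂ ζ ((1 - a) ζ) = ((‖(r : H →L[ℂ] H) ζ‖ ^ 2 : ℝ) : ℂ) := fun ζ => by
      rw [← hrr]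
      nth_rw 1 [← hrs]
      change inner ℂ ζ (((r : H →L[ℂ] H)†) ((r : H →L[ℂ] H) ζ)) = _
      rw [ContinuousLinearMap.adjoint_inner_right, inner_self_eq_norm_sq_to_K]
      push_cast
      rfl
    have hb0 : (0 : H →L[ℂ] H) ≤ b := by
      rw [ContinuousLinearMap.le_iff_inner_le]
      intro ζ
      rw [hb, zero_apply, inner_zero_right]
      exact_mod_cast by positivity
    have hb1 : (b : H →L[ℂ] H) ≤ 1 - a := by
      rw [ContinuousLinearMap.le_iff_inner_le]
      intro ζ
      rw [hb, hq, Complex.real_le_real, inv_mul_le_iff₀ hC]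
      calc ‖(y : H →L[ℂ] H) ζ‖ ^ 2
          ≤ (‖(x : H →L[ℂ] H)‖ * ‖(r : H →L[ℂ] H) ζ‖) ^ 2 := by
            gcongr
            exact (x : H →L[ℂ] H).le_opNorm _
        _ ≤ C * ‖(r : H →L[ℂ] H) ζ‖ ^ 2 := by
            rw [mul_pow]
            gcongr
            simp [C]
    have hmem : a + b ∈ S := by
      refine ⟨add_mem haM b.2, add_nonneg ha0 hb0, le_sub_iff_add_le'.1 hb1, ?_⟩
      have h1 : (⟨a + b, add_mem haM b.2⟩ : M.toStarSubalgebra) = ⟨a, haM⟩ + b := rfl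
      have h2 : (inner ℂ ξ ((b : H →L[ℂ] H) ξ)).re ≤ (inner ℂ η ((σ b : K →L[ℂ] K) η)).re := by
        rw [hb, hσb, Complex.ofReal_re, Complex.ofReal_re]
        have : ‖(y : H →L[ℂ] H) ξ‖ ≤ ‖(σ y : K →L[ℂ] K) η‖ := by
          simp only [y, map_mul]
          exact hlt.le
        gcongr
      rw [h1, map_add]
      have h3 := add_le_add haξ h2
      rw [← Complex.add_re, ← Complex.add_re, ← inner_add_right, ← inner_add_right] at h3
      exact h3
    have hb2 : (b : H →L[ℂ] H) ≤ 0 := by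
      have := hmax hmem (le_add_of_nonneg_right hb0)
      simpa using this
    have hy0 : y = 0 := Subtype.ext <| ContinuousLinearMap.ext fun ζ => by
      have h1 := ContinuousLinearMap.le_iff_inner_le.1 hb2 ζ
      rw [hb, zero_apply, inner_zero_right, ← Complex.ofReal_zero,
        Complex.real_le_real, inv_mul_le_iff₀ hC, mul_zero] at h1
      have h2 : ‖(y : H →L[ℂ] H) ζ‖ = 0 := by
        exact pow_eq_zero_iff two_ne_zero |>.1 (le_antisymm h1 (by positivity))
      exact norm_eq_zero.1 h2
    have h0 : (σ x : K →L[ℂ] K) ((σ r : K →L[ℂ] K) η) = (σ y : K →L[ℂ] K) η := by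
      simp [y]
    rw [h0, hy0, map_zero] at hlt
    exact absurd hlt (by simp)

/-- Isomorphic von Neumann algebras have no disjoint subrepresentations: the intertwiners separate
the vectors. -/
theorem exists_intertwiner_apply_ne_zero {M : VonNeumannAlgebra H} {N : VonNeumannAlgebra K}
    (σ : M.toStarSubalgebra ≃⋆ₐ[ℂ] N.toStarSubalgebra) {η : K} (hη : η ≠ 0) :
    ∃ T : K →L[ℂ] H, (∀ (x : M.toStarSubalgebra) k,
      T ((σ x : K →L[ℂ] K) k) = (x : H →L[ℂ] H) (T k)) ∧ T η ≠ 0 := by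
  obtain ⟨r, ξ, hrs, hr, hle⟩ := exists_norm_map_apply_le σ hη
  obtain ⟨S, hS, hSξ⟩ := exists_intertwiner_of_norm_le σ hle
  refine ⟨S†, fun x k => ?_, fun h => hr ?_⟩
  · refine ext_inner_right ℂ fun h => ?_
    have h1 := hS (star x) h
    rw [map_star] at h1
    rw [ContinuousLinearMap.adjoint_inner_left, ← ContinuousLinearMap.adjoint_inner_right]
    change inner ℂ k ((star (σ x) : N.toStarSubalgebra).1 (S h)) = _
    rw [← h1, ← ContinuousLinearMap.adjoint_inner_left]
    exact ContinuousLinearMap.adjoint_inner_right (x : H →L[ℂ] H) _ _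
  -- Since S rξ = σ(r)η and r is self-adjoint, this inner product equals ‖σ(r)η‖².
  · have h1 : inner ℂ ((S†) η) ((r : H →L[ℂ] H) ((r : H →L[ℂ] H) ξ)) = 0 := by
      rw [h, inner_zero_left]
    have h2 : (σ r : K →L[ℂ] K) = (σ r : K →L[ℂ] K)† := by
      conv_lhs => rw [← hrs, map_star]
      rfl
    rw [ContinuousLinearMap.adjoint_inner_left, hS, hSξ, h2,
      ContinuousLinearMap.adjoint_inner_right, ← h2, inner_self_eq_zero] at h1
    exact h1

/-! ### Resolutions of the identity by intertwiners -/

/-- `T` intertwines the representation `σ` of `M` on `K` with the identity representation. -/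
def Intertwines {M : VonNeumannAlgebra H} {N : VonNeumannAlgebra K}
    (σ : M.toStarSubalgebra ≃⋆ₐ[ℂ] N.toStarSubalgebra) (T : K →L[ℂ] H) : Prop :=
  ∀ (x : M.toStarSubalgebra) k, T ((σ x : K →L[ℂ] K) k) = (x : H →L[ℂ] H) (T k)

namespace Intertwines

variable {M : VonNeumannAlgebra H} {N : VonNeumannAlgebra K}
  {σ : M.toStarSubalgebra ≃⋆ₐ[ℂ] N.toStarSubalgebra} {T : K →L[ℂ] H}

theorem smul (hT : Intertwines σ T) (c : ℂ) : Intertwines σ (c • T) := fun x k => by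
  simp [hT x k]

theorem comp (hT : Intertwines σ T) {r : K →L[ℂ] K} (hr : r ∈ N.commutant) :
    Intertwines σ (T ∘L r) := fun x k => by
  have h : (σ x : K →L[ℂ] K) * r = r * σ x := mem_commutant_iff.1 hr _ (σ x).2
  have h' : r ((σ x : K →L[ℂ] K) k) = (σ x : K →L[ℂ] K) (r k) :=
    (congrArg (fun S : K →L[ℂ] K => S k) h).symm
  rw [ContinuousLinearMap.comp_apply, h', hT, ContinuousLinearMap.comp_apply]

theorem adjoint_apply (hT : Intertwines σ T) (x : M.toStarSubalgebra) (h : H) :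
    (T†) ((x : H →L[ℂ] H) h) = (σ x : K →L[ℂ] K) ((T†) h) := by
  refine ext_inner_right ℂ fun k => ?_
  have h1 := hT (star x) k
  rw [map_star] at h1
  rw [ContinuousLinearMap.adjoint_inner_left, ← ContinuousLinearMap.adjoint_inner_right]
  change inner ℂ h ((star x : M.toStarSubalgebra).1 (T k)) = _
  rw [← h1, ← ContinuousLinearMap.adjoint_inner_left]
  exact ContinuousLinearMap.adjoint_inner_right (σ x : K →L[ℂ] K) _ _

theorem adjoint_comp_self_mem (hT : Intertwines σ T) : (T†) ∘L T ∈ N.commutant := by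
  rw [mem_commutant_iff]
  intro g hg
  obtain ⟨x, hx⟩ := (EquivLike.surjective σ) ⟨g, hg⟩
  refine ContinuousLinearMap.ext fun k => ?_
  have hx' : (σ x : K →L[ℂ] K) = g := congrArg Subtype.val hx
  change g ((T†) (T k)) = (T†) (T (g k))
  rw [← hx', hT, hT.adjoint_apply]

end Intertwines

/-- A representation on `K` isomorphic to `M` admits a resolution of the identity by
intertwiners. -/
theorem exists_family_intertwines {M : VonNeumannAlgebra H} {N : VonNeumannAlgebra K}
    (σ : M.toStarSubalgebra ≃⋆ₐ[ℂ] N.toStarSubalgebra) :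
    ∃ T : ℕ × (K →L[ℂ] H) → K →L[ℂ] H, (∀ i, Intertwines σ (T i)) ∧
      ∀ k, HasSum (fun i => ‖T i k‖ ^ 2) (‖k‖ ^ 2) := by
  classical
  -- The factor ℕ allows one operator to occur repeatedly.
  let ι := ℕ × (K →L[ℂ] H)
  -- Testing only finite subsets gives the property finite character, hence a maximal family.
  let 𝓕 : Set (Set ι) := {F | ∀ s : Finset ι, (s : Set ι) ⊆ F →
    (∀ p ∈ s, Intertwines σ p.2) ∧ ∀ k, ∑ p ∈ s, ‖p.2 k‖ ^ 2 ≤ ‖k‖ ^ 2}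
  have h𝓕 : Order.IsOfFiniteCharacter 𝓕 := fun F =>
    ⟨fun hF G hG _ s hs => hF s (hs.trans hG),
      fun hF s hs => hF s hs s.finite_toSet s subset_rfl⟩
  obtain ⟨F, -, hF⟩ := h𝓕.exists_maximal (x := ∅) fun s hs => by
    have : s = ∅ := by simpa using hs
    subst this
    simp
  let T : ι → K →L[ℂ] H := fun p => if p ∈ F then p.2 else 0
  have hT : ∀ p, Intertwines σ (T p) := fun p => by
    by_cases hp : p ∈ F
    · simpa [T, hp] using (hF.prop {p} (by simpa using hp)).1 p (by simp)
    · intro x k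
      simp [T, hp]
  have hTsum : ∀ (s : Finset ι) k, ∑ p ∈ s, ‖T p k‖ ^ 2 =
      ∑ p ∈ s.filter (· ∈ F), ‖p.2 k‖ ^ 2 := fun s k => by
    rw [Finset.sum_filter]
    refine Finset.sum_congr rfl fun p _ => ?_
    by_cases hp : p ∈ F <;> simp [T, hp]
  have hTle : ∀ (s : Finset ι) k, ∑ p ∈ s, ‖T p k‖ ^ 2 ≤ ‖k‖ ^ 2 := fun s k => by
    rw [hTsum]
    exact (hF.prop _ fun p hp => by simpa using (Finset.mem_filter.1 hp).2).2 k
  refine ⟨T, hT, ?_⟩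
  let A : Finset ι → K →L[ℂ] K := fun s => ∑ p ∈ s, (T p†) ∘L T p
  have hA : ∀ s k, inner ℂ k (A s k) = ((∑ p ∈ s, ‖T p k‖ ^ 2 : ℝ) : ℂ) := fun s k => by
    simp only [A, sum_apply, inner_sum, ContinuousLinearMap.comp_apply,
      ContinuousLinearMap.adjoint_inner_right, inner_self_eq_norm_sq_to_K]
    push_cast
    rfl
  have hk2 : ∀ k : K, inner ℂ k k = ((‖k‖ ^ 2 : ℝ) : ℂ) := fun k => by
    rw [inner_self_eq_norm_sq_to_K]
    push_cast
    rfl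
  have hmono : ∀ s t : Finset ι, s ⊆ t → A s ≤ A t := fun s t hst => by
    rw [ContinuousLinearMap.le_iff_inner_le]
    intro k
    rw [hA, hA, Complex.real_le_real]
    exact Finset.sum_le_sum_of_subset_of_nonneg hst fun _ _ _ => by positivity
  let l : Ultrafilter (Finset ι) := Ultrafilter.of atTop
  have hl : (l : Filter (Finset ι)) ≤ atTop := Ultrafilter.of_le _
  obtain ⟨a, haM, ha1, ha2, ha3⟩ := exists_tendsto_of_eventually_le N.commutant l A
    (fun s => sum_mem fun p _ => (hT p).adjoint_comp_self_mem)
    (fun s => by simpa [A] using hmono ∅ s (by simp))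
    (fun s => by
      rw [ContinuousLinearMap.le_iff_inner_le]
      intro k
      rw [hA, one_apply_eq_self, hk2, Complex.real_le_real]
      exact hTle s k)
    (fun s => hl (eventually_ge_atTop s |>.mono fun t ht => hmono s t ht))
  have ha_le : a ≤ 1 := ha2 _ fun s => by
    rw [ContinuousLinearMap.le_iff_inner_le]
    intro k
    rw [hA, one_apply_eq_self, hk2, Complex.real_le_real]
    exact hTle s k
  have ha : a = 1 := by
    by_contra hne
    have hq0 : (0 : K →L[ℂ] K) ≤ 1 - a := sub_nonneg.2 ha_le
    -- The defect 1 - a = r² lies in N'. A nonzero intertwiner, scaled to a contraction and composed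
    -- with r, is an intertwiner G with G*G ≤ 1 - a, and so fits into the family.
    set r := CFC.sqrt (1 - a)
    have hrM : r ∈ N.commutant := sqrt_mem (sub_mem (one_mem _) haM)
    have hrr : r * r = 1 - a := CFC.sqrt_mul_sqrt_self _ hq0
    have hrs : star r = r := (CFC.sqrt_nonneg (1 - a)).isSelfAdjoint.star_eq
    have hrk : ∀ k, ((‖r k‖ ^ 2 : ℝ) : ℂ) = ((‖k‖ ^ 2 : ℝ) : ℂ) - inner ℂ k (a k) := fun k => by
      rw [← hk2 k, ← inner_sub_right]
      change _ = inner ℂ k ((1 - a) k)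
      rw [← hrr]
      nth_rw 2 [← hrs]
      change _ = inner ℂ k ((r†) (r k))
      rw [ContinuousLinearMap.adjoint_inner_right, inner_self_eq_norm_sq_to_K]
      push_cast
      rfl
    obtain ⟨k₀, hk₀⟩ : ∃ k, r k ≠ 0 := by
      by_contra! h
      have : r = 0 := ContinuousLinearMap.ext h
      rw [this, mul_zero] at hrr
      exact hne (sub_eq_zero.1 hrr.symm).symm
    obtain ⟨T₀, hT₀, hT₀k⟩ := exists_intertwiner_apply_ne_zero σ hk₀
    let c : ℝ := (‖T₀‖ + 1)⁻¹
    have hc : 0 < c := by positivity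
    let G : K →L[ℂ] H := ((c : ℂ) • T₀) ∘L r
    have hG : Intertwines σ G := (Intertwines.smul hT₀ _).comp hrM
    have hGle : ∀ k, ‖G k‖ ≤ ‖r k‖ := fun k => by
      change ‖(c : ℂ) • T₀ (r k)‖ ≤ _
      rw [norm_smul, Complex.norm_real, Real.norm_of_nonneg hc.le,
        inv_mul_le_iff₀ (by positivity)]
      refine (T₀.le_opNorm _).trans ?_
      gcongr
      linarith
    have hGk : 0 < ‖G k₀‖ ^ 2 := by
      have : G k₀ ≠ 0 := smul_ne_zero (by exact_mod_cast hc.ne') hT₀k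
      have := norm_pos_iff.2 this
      positivity
    -- Infinitely many copies of G in F would make the sums at k₀ unbounded, so some copy is unused.
    obtain ⟨n, hn⟩ : ∃ n : ℕ, (n, G) ∉ F := by
      by_contra! h
      obtain ⟨m, hm⟩ := exists_nat_gt (‖k₀‖ ^ 2 / ‖G k₀‖ ^ 2)
      have := (hF.prop ((Finset.range m).image fun n => (n, G)) (by
        intro p hp
        obtain ⟨n, -, rfl⟩ := Finset.mem_image.1 (Finset.mem_coe.1 hp)
        exact h n)).2 k₀
      rw [Finset.sum_image (fun _ _ _ _ h => congrArg Prod.fst h)] at this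
      simp only [Finset.sum_const, Finset.card_range, nsmul_eq_mul] at this
      rw [div_lt_iff₀ hGk] at hm
      linarith
    refine hn (hF.le_of_ge (y := insert (n, G) F) ?_ (Set.subset_insert _ _)
      (Set.mem_insert _ _))
    intro s hs
    have hsF : (s.erase (n, G) : Set ι) ⊆ F := fun p hp => by
      rw [Finset.mem_coe, Finset.mem_erase] at hp
      exact (hs hp.2).resolve_left hp.1
    refine ⟨fun p hp => ?_, fun k => ?_⟩
    · by_cases hpe : p = (n, G)
      · rw [hpe]
        exact hG
      · exact (hF.prop _ hsF).1 p (Finset.mem_erase.2 ⟨hpe, hp⟩)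
    · have h1 : ∑ p ∈ s, ‖p.2 k‖ ^ 2 ≤ ‖G k‖ ^ 2 + ∑ p ∈ s.erase (n, G), ‖p.2 k‖ ^ 2 := by
        rw [← Finset.sum_insert (f := fun p : ι => ‖p.2 k‖ ^ 2) (Finset.notMem_erase (n, G) s)]
        exact Finset.sum_le_sum_of_subset_of_nonneg
          (fun p hp => by
            by_cases hpe : p = (n, G)
            · simp [hpe]
            · exact Finset.mem_insert_of_mem (Finset.mem_erase.2 ⟨hpe, hp⟩))
          fun _ _ _ => by positivity
      have h2 : ∑ p ∈ s.erase (n, G), ‖p.2 k‖ ^ 2 = ∑ p ∈ s.erase (n, G), ‖T p k‖ ^ 2 :=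
        Finset.sum_congr rfl fun p hp => by simp [T, hsF hp]
      have h3 : ((∑ p ∈ s.erase (n, G), ‖T p k‖ ^ 2 : ℝ) : ℂ) ≤ inner ℂ k (a k) := by
        rw [← hA]
        exact ContinuousLinearMap.le_iff_inner_le.1 (ha1 _) k
      have h4 : (∑ p ∈ s.erase (n, G), ‖T p k‖ ^ 2) ≤ ‖k‖ ^ 2 - ‖r k‖ ^ 2 := by
        rw [← Complex.real_le_real, Complex.ofReal_sub, hrk]
        simpa using h3
      have h5 : ‖G k‖ ^ 2 ≤ ‖r k‖ ^ 2 := by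
        gcongr
        exact hGle k
      linarith
  intro k
  have hs : Summable fun i => ‖T i k‖ ^ 2 :=
    summable_of_sum_le (fun _ => by positivity) fun s => hTle s k
  have h1 := (ha3 k k).congr fun s => hA s k
  have h2 := (Complex.continuous_ofReal.tendsto _).comp (hs.hasSum.mono_left hl)
  have h3 := tendsto_nhds_unique h2 h1
  rw [ha, one_apply_eq_self, hk2] at h3
  rw [← Complex.ofReal_injective h3]
  exact hs.hasSum

end VonNeumannAlgebra

/-! ### Hilbert sums of copies of one space -/

/-- The column isometry given by operators whose squares sum up to the identity. -/
theorem exists_isometry_lp {F H K : Type*}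
    [NormedAddCommGroup H] [InnerProductSpace ℂ H] [NormedAddCommGroup K] [InnerProductSpace ℂ K]
    (T : F → K →L[ℂ] H)
    (hT : ∀ k, HasSum (fun f => ‖T f k‖ ^ 2) (‖k‖ ^ 2)) :
    ∃ R : K →ₗᵢ[ℂ] lp (fun _ : F => H) 2, ∀ k f, R k f = T f k := by
  have hmem : ∀ k, Memℓp (fun f => T f k) 2 := fun k => by
    refine memℓp_gen ?_
    simpa using (hT k).summable
  refine ⟨⟨{ toFun := fun k => ⟨fun f => T f k, hmem k⟩
             map_add' := fun x y => by ext f; exact map_add (T f) x y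
             map_smul' := fun c x => by ext f; simp }, fun k => ?_⟩, fun k f => rfl⟩
  have h := lp.norm_rpow_eq_tsum (p := 2) (by norm_num)
    (⟨fun f => T f k, hmem k⟩ : lp (fun _ : F => H) 2)
  simp only [ENNReal.toReal_ofNat, Real.rpow_ofNat] at h
  rw [← sq_eq_sq₀ (norm_nonneg _) (norm_nonneg _)]
  exact h.trans (hT k).tsum_eq

section HilbertSum

variable {J H X : Type*}
  [NormedAddCommGroup H] [InnerProductSpace ℂ H] [CompleteSpace H]
  [NormedAddCommGroup X] [InnerProductSpace ℂ X] [CompleteSpace X]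
  {V : J → H →ₗᵢ[ℂ] X}

theorem IsHilbertSum.linearIsometryEquiv_apply_eq_adjoint
    (hV : IsHilbertSum ℂ (fun _ : J => H) V) (z : X) (j : J) :
    hV.linearIsometryEquiv z j = ((V j).toContinuousLinearMap†) z := by
  classical
  refine ext_inner_right ℂ fun h => ?_
  rw [ContinuousLinearMap.adjoint_inner_left]
  change _ = inner ℂ z (V j h)
  rw [← hV.linearIsometryEquiv_symm_apply_single, ← LinearIsometryEquiv.inner_map_map
    hV.linearIsometryEquiv, LinearIsometryEquiv.apply_symm_apply, lp.inner_single_right]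

theorem IsHilbertSum.hasSum_adjoint (hV : IsHilbertSum ℂ (fun _ : J => H) V) (z : X) :
    HasSum (fun j => V j (((V j).toContinuousLinearMap†) z)) z := by
  simpa [hV.linearIsometryEquiv_apply_eq_adjoint] using
    hV.hasSum_linearIsometryEquiv_symm (hV.linearIsometryEquiv z)

theorem IsHilbertSum.clm_ext {E : Type*} [NormedAddCommGroup E] [NormedSpace ℂ E]
    (hV : IsHilbertSum ℂ (fun _ : J => H) V) {S T : X →L[ℂ] E}
    (h : ∀ j x, S (V j x) = T (V j x)) : S = T := by
  refine ContinuousLinearMap.ext fun z => ?_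
  have h1 := (hV.hasSum_adjoint z).mapL S
  simp only [h] at h1
  exact h1.unique ((hV.hasSum_adjoint z).mapL T)

theorem IsHilbertSum.adjoint_apply_apply_self (V : J → H →ₗᵢ[ℂ] X) (j : J) (x : H) :
    ((V j).toContinuousLinearMap†) (V j x) = x := by
  refine ext_inner_right ℂ fun h => ?_
  rw [ContinuousLinearMap.adjoint_inner_left]
  exact (V j).inner_map_map x h

theorem IsHilbertSum.adjoint_apply_apply_of_ne (hV : IsHilbertSum ℂ (fun _ : J => H) V)
    {i j : J} (hij : i ≠ j) (x : H) : ((V i).toContinuousLinearMap†) (V j x) = 0 := by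
  refine ext_inner_right ℂ fun h => ?_
  rw [ContinuousLinearMap.adjoint_inner_left, inner_zero_left]
  exact hV.OrthogonalFamily hij.symm x h

/-- The projection of a Hilbert sum onto finitely many summands. -/
noncomputable def hilbertSumProj (V : J → H →ₗᵢ[ℂ] X) (s : Finset J) : X →L[ℂ] X :=
  ∑ j ∈ s, (V j).toContinuousLinearMap ∘L ((V j).toContinuousLinearMap†)

theorem hilbertSumProj_apply (V : J → H →ₗᵢ[ℂ] X) (s : Finset J) (z : X) :
    hilbertSumProj V s z = ∑ j ∈ s, V j (((V j).toContinuousLinearMap†) z) := by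
  simp [hilbertSumProj, sum_apply]

/-- Together with self-adjointness and contractivity below, this makes the finite projections usable
for approximating operators by compressions in the w*-topology. -/
theorem IsHilbertSum.tendsto_hilbertSumProj (hV : IsHilbertSum ℂ (fun _ : J => H) V) (z : X) :
    Tendsto (fun s => hilbertSumProj V s z) atTop (𝓝 z) := by
  simp only [hilbertSumProj_apply]
  exact hV.hasSum_adjoint z

theorem inner_hilbertSumProj (V : J → H →ₗᵢ[ℂ] X) (s : Finset J) (x y : X) :
    inner ℂ (hilbertSumProj V s x) y = inner ℂ x (hilbertSumProj V s y) := by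
  rw [hilbertSumProj_apply, hilbertSumProj_apply, sum_inner, inner_sum]
  refine Finset.sum_congr rfl fun j _ => ?_
  change inner ℂ ((V j).toContinuousLinearMap _) y = inner ℂ x ((V j).toContinuousLinearMap _)
  rw [← ContinuousLinearMap.adjoint_inner_right, ContinuousLinearMap.adjoint_inner_left]

theorem IsHilbertSum.hilbertSumProj_idem (hV : IsHilbertSum ℂ (fun _ : J => H) V)
    (s : Finset J) (z : X) : hilbertSumProj V s (hilbertSumProj V s z) = hilbertSumProj V s z := by
  rw [hilbertSumProj_apply, hilbertSumProj_apply]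
  refine Finset.sum_congr rfl fun i hi => ?_
  rw [map_sum, Finset.sum_eq_single i]
  · rw [IsHilbertSum.adjoint_apply_apply_self]
  · intro j _ hj
    exact hV.adjoint_apply_apply_of_ne hj.symm _
  · exact fun h => absurd hi h

theorem IsHilbertSum.norm_hilbertSumProj_le (hV : IsHilbertSum ℂ (fun _ : J => H) V)
    (s : Finset J) (z : X) : ‖hilbertSumProj V s z‖ ≤ ‖z‖ := by
  have h1 : ‖hilbertSumProj V s z‖ ^ 2 ≤ ‖z‖ * ‖hilbertSumProj V s z‖ := by
    rw [← inner_self_eq_norm_sq (𝕜 := ℂ), inner_hilbertSumProj, hV.hilbertSumProj_idem]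
    exact (RCLike.re_le_norm _).trans (norm_inner_le_norm _ _)
  rcases (norm_nonneg (hilbertSumProj V s z)).eq_or_lt with h | h
  · rw [← h]
    exact norm_nonneg _
  · rw [sq] at h1
    exact le_of_mul_le_mul_right h1 h

end HilbertSum

/-- A resolution of the identity by operators from `K` to `H` gives an isometry between
amplifications whose index set absorbs the index set of the resolution. -/
theorem exists_isometry_of_resolution {F J H K X Y : Type*}
    [NormedAddCommGroup H] [InnerProductSpace ℂ H] [NormedAddCommGroup K] [InnerProductSpace ℂ K]
    [NormedAddCommGroup X] [InnerProductSpace ℂ X] [CompleteSpace X]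
    [NormedAddCommGroup Y] [InnerProductSpace ℂ Y] [CompleteSpace Y]
    {V : J → H →ₗᵢ[ℂ] X} {W : J → K →ₗᵢ[ℂ] Y} (T : F → K →L[ℂ] H)
    (hT : ∀ k, HasSum (fun f => ‖T f k‖ ^ 2) (‖k‖ ^ 2)) {c : F → J → J}
    (hc : Function.Injective2 c)
    (hV : IsHilbertSum ℂ (fun _ : J => H) V) (hW : IsHilbertSum ℂ (fun _ : J => K) W) :
    ∃ S : Y →ₗᵢ[ℂ] X, ∀ j k, HasSum (fun f => V (c f j) (T f k)) (S (W j k)) := by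
  classical
  obtain ⟨R, hR⟩ := exists_isometry_lp T hT
  have hVj : ∀ j, OrthogonalFamily ℂ (fun _ : F => H) fun f => V (c f j) := fun j =>
    hV.OrthogonalFamily.comp (hc.left j)
  -- The j-th copy of K is sent by the column of the T f into the summands indexed by c(f, j). Joint
  -- injectivity of c keeps these summands distinct for each j and disjoint for different j.
  let S : J → K →ₗᵢ[ℂ] X := fun j => (hVj j).linearIsometry.comp R
  have hS : ∀ j k, HasSum (fun f => V (c f j) (T f k)) (S j k) := fun j k => by
    have h := (hVj j).hasSum_linearIsometry (R k)
    simp only [hR] at h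
    exact h
  have hSo : OrthogonalFamily ℂ (fun _ : J => K) S := fun i j hij x y => by
    have h1 : ∀ f, inner ℂ (S i x) (V (c f j) (T f y)) = 0 := fun f => by
      have h2 : ∀ g, inner ℂ (V (c f j) (T f y)) (V (c g i) (T g x)) = 0 := fun g =>
        hV.OrthogonalFamily (fun h => hij (hc h).2.symm) _ _
      have h3 := (hS i x).mapL (innerSL ℂ (V (c f j) (T f y)))
      simp only [innerSL_apply_apply, h2] at h3
      rw [inner_eq_zero_symm]
      exact h3.unique hasSum_zero
    have h3 := (hS j y).mapL (innerSL ℂ (S i x))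
    simp only [innerSL_apply_apply, h1] at h3
    exact h3.unique hasSum_zero
  refine ⟨hSo.linearIsometry.comp hW.linearIsometryEquiv.toLinearIsometry, fun j k => ?_⟩
  have : hW.linearIsometryEquiv (W j k) = lp.single 2 j k := by
    rw [← hW.linearIsometryEquiv_symm_apply_single, LinearIsometryEquiv.apply_symm_apply]
  change HasSum _ (hSo.linearIsometry (hW.linearIsometryEquiv (W j k)))
  rw [this, hSo.linearIsometry_apply_single]
  exact hS j k

/-! ### H ⊗ ℓ²_J as a sum of J copies of H -/

section HilbertTensor

variable {H : Type*} [NormedAddCommGroup H] [InnerProductSpace ℂ H]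
  {J : Type*}

open scoped Classical in
/-- The embedding of `H` as the `j`-th summand of `H ⊗ ℓ²_J`. -/
noncomputable def tensorSingle (H : Type*) [NormedAddCommGroup H] [InnerProductSpace ℂ H]
    {J : Type*} (j : J) : H →ₗᵢ[ℂ] HilbertTensor H (EllTwo J) where
  toFun h := ((h ⊗ₜ[ℂ] (lp.single 2 j (1 : ℂ) : EllTwo J) : H ⊗[ℂ] EllTwo J) :
    HilbertTensor H (EllTwo J))
  map_add' x y := by rw [TensorProduct.add_tmul, UniformSpace.Completion.coe_add]
  map_smul' c x := by
    rw [← TensorProduct.smul_tmul', UniformSpace.Completion.coe_smul, RingHom.id_apply]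
  norm_map' x := by
    change ‖((_ : H ⊗[ℂ] EllTwo J) : HilbertTensor H (EllTwo J))‖ = _
    rw [UniformSpace.Completion.norm_coe, TensorProduct.norm_tmul, lp.norm_single (by norm_num)]
    simp

open scoped Classical in
theorem tensorSingle_apply (j : J) (h : H) :
    tensorSingle H j h = ((h ⊗ₜ[ℂ] (lp.single 2 j (1 : ℂ) : EllTwo J) : H ⊗[ℂ] EllTwo J) :
      HilbertTensor H (EllTwo J)) := rfl

/-- Totality follows from h ⊗ v = ∑ vⱼ (h ⊗ eⱼ) and the density of the algebraic tensor product. -/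
theorem isHilbertSum_tensorSingle [CompleteSpace H] :
    IsHilbertSum ℂ (fun _ : J => H) (tensorSingle H (J := J)) := by
  classical
  refine IsHilbertSum.mk (fun i j hij x y => ?_) ?_
  · rw [tensorSingle_apply, tensorSingle_apply, UniformSpace.Completion.inner_coe,
      TensorProduct.inner_tmul, lp.inner_single_left, lp.single_apply_ne _ _ _ hij, inner_zero_right,
      mul_zero]
  · set P := (⨆ j : J, LinearMap.range (tensorSingle H j).toLinearMap).topologicalClosure
    have hPc : IsClosed (P : Set (HilbertTensor H (EllTwo J))) :=
      Submodule.isClosed_topologicalClosure _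
    have h1 : ∀ (h : H) (v : EllTwo J),
        ((h ⊗ₜ[ℂ] v : H ⊗[ℂ] EllTwo J) : HilbertTensor H (EllTwo J)) ∈ P := fun h v => by
      let f : EllTwo J →L[ℂ] HilbertTensor H (EllTwo J) :=
        UniformSpace.Completion.toComplL ∘L TensorProduct.mkL ℂ H (EllTwo J) h
      have h2 := (lp.hasSum_single (by norm_num) v).mapL f
      refine hPc.mem_of_tendsto h2 (Eventually.of_forall fun s => P.sum_mem fun j _ => ?_)
      have h3 : (lp.single 2 j (v j) : EllTwo J) = v j • lp.single 2 j (1 : ℂ) := by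
        rw [← lp.single_smul, smul_eq_mul, mul_one]
      rw [h3, map_smul]
      refine P.smul_mem _ (Submodule.le_topologicalClosure _ ?_)
      exact Submodule.mem_iSup_of_mem j ⟨h, rfl⟩
    intro z _
    refine UniformSpace.Completion.denseRange_coe.induction_on (p := fun z => z ∈ P) z hPc
      fun t => ?_
    induction t using TensorProduct.induction_on with
    | zero => exact P.zero_mem
    | tmul h v => exact h1 h v
    | add x y hx hy =>
      rw [UniformSpace.Completion.coe_add]
      exact P.add_mem hx hy

theorem opTensor_one_tensorSingle (x : H →L[ℂ] H) (j : J) (h : H) :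
    opTensor x 1 (tensorSingle H j h) = tensorSingle H j (x h) :=
  opTensor_tmul _ _ _ _

end HilbertTensor

/-! ### The w*-topology -/

section WeakStar

variable {X : Type*} [NormedAddCommGroup X] [InnerProductSpace ℂ X]

/-- A vector functional is the case of sequences supported at index 0. -/
theorem continuous_weakStar_inner (x y : X) :
    @Continuous _ _ (weakStarTopology X) _ fun T : X →L[ℂ] X => inner ℂ x (T y) := by
  have h : (fun T : X →L[ℂ] X => inner ℂ x (T y)) = (fun g => g (lp.single 2 0 x, lp.single 2 0 y)) ∘
      (fun (T : X →L[ℂ] X) (p : lp (fun _ : ℕ => X) 2 × lp (fun _ : ℕ => X) 2) =>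
        ∑' n, inner ℂ (p.1 n) (T (p.2 n))) := by
    funext T
    simp only [Function.comp_apply]
    rw [tsum_eq_single 0]
    · simp
    · intro n hn
      simp [hn]
  rw [h]
  let := weakStarTopology X
  exact (continuous_apply _).comp continuous_induced_dom

/-- If self-adjoint contractions `P i` converge strongly to the identity, then the compressions
`P i ∘ T ∘ P i` converge to `T` in the `w*`-topology. -/
theorem tendsto_weakStar_compression {ι : Type*} {l : Filter ι} (P : ι → X →L[ℂ] X)
    (hPn : ∀ i x, ‖P i x‖ ≤ ‖x‖) (hPs : ∀ i x y, inner ℂ (P i x) y = inner ℂ x (P i y))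
    (hP : ∀ x, Tendsto (fun i => P i x) l (𝓝 x)) (T : X →L[ℂ] X) :
    Tendsto (fun i => P i ∘L T ∘L P i) l (@nhds _ (weakStarTopology X) T) := by
  rw [nhds_induced, tendsto_comap_iff, tendsto_pi_nhds]
  rintro ⟨x, y⟩
  -- By Hölder, this is a summable majorant independent of i, so limits pass through the series by
  -- dominated convergence.
  have hxy : Summable fun n => ‖T‖ * (‖x n‖ * ‖y n‖) := by
    refine Summable.mul_left _ ?_
    have h : ∀ z : lp (fun _ : ℕ => X) 2, Summable fun n => ‖z n‖ ^ (2 : ℝ) := fun z => by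
      simpa using (lp.memℓp z).summable (by norm_num)
    exact Real.summable_mul_of_Lp_Lq_of_nonneg Real.HolderConjugate.two_two
      (fun _ => norm_nonneg _) (fun _ => norm_nonneg _) (h x) (h y)
  refine tendsto_tsum_of_dominated_convergence hxy (fun n => ?_) (Eventually.of_forall fun i n => ?_)
  · simp only [ContinuousLinearMap.comp_apply, ← hPs]
    exact (hP (x n)).inner ((T.continuous.tendsto _).comp (hP (y n)))
  · simp only [ContinuousLinearMap.comp_apply, ← hPs]
    calc ‖inner ℂ (P i (x n)) (T (P i (y n)))‖ ≤ ‖P i (x n)‖ * ‖T (P i (y n))‖ :=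
          norm_inner_le_norm _ _
      _ ≤ ‖x n‖ * (‖T‖ * ‖y n‖) := by
          gcongr
          · exact hPn _ _
          · exact (T.le_opNorm _).trans (by gcongr; exact hPn _ _)
      _ = _ := by ring

end WeakStar

/-! ### The commutation theorem for A ⊗̄ M_J -/

section Commutant

variable {H : Type*} [NormedAddCommGroup H] [InnerProductSpace ℂ H] [CompleteSpace H] {J : Type*}

/-- The commutation theorem for the tensor product with a full matrix algebra. -/
theorem mem_normalSpatialTensor_matrixAlgebra_iff (A : VonNeumannAlgebra H)
    {T : HilbertTensor H (EllTwo J) →L[ℂ] HilbertTensor H (EllTwo J)} :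
    T ∈ normalSpatialTensor (A : Set (H →L[ℂ] H)) (matrixAlgebra J) ↔
      ∀ x ∈ A.commutant, ∀ z, T (opTensor x 1 z) = opTensor x 1 (T z) := by
  classical
  have hι := isHilbertSum_tensorSingle (H := H) (J := J)
  constructor
  · intro hT x hx z
    -- Commutation with x ⊗ 1 is written in matrix coefficients, which makes it visibly w*-closed.
    let C : Submodule ℂ (HilbertTensor H (EllTwo J) →L[ℂ] HilbertTensor H (EllTwo J)) :=
      { carrier := {S | ∀ ξ η, inner ℂ ξ (S (opTensor x 1 η)) = inner ℂ ((opTensor x 1†) ξ) (S η)}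
        zero_mem' := fun ξ η => by simp
        add_mem' := fun {S S'} h h' ξ η => by
          rw [add_apply, add_apply, inner_add_right, inner_add_right, h, h']
        smul_mem' := fun c S h ξ η => by
          rw [smul_apply, smul_apply, inner_smul_right, inner_smul_right, h] }
    have hC : @IsClosed _ (weakStarTopology (HilbertTensor H (EllTwo J))) (C : Set _) := by
      have : (C : Set (HilbertTensor H (EllTwo J) →L[ℂ] HilbertTensor H (EllTwo J))) =
          ⋂ ξ, ⋂ η, {S | inner ℂ ξ (S (opTensor x 1 η)) = inner ℂ ((opTensor x 1†) ξ) (S η)} := by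
        ext S
        simp only [Set.mem_iInter]
        rfl
      rw [this]
      refine @isClosed_iInter _ _ (weakStarTopology _) _ fun ξ =>
        @isClosed_iInter _ _ (weakStarTopology _) _ fun η => ?_
      exact @isClosed_eq _ _ _ (weakStarTopology (HilbertTensor H (EllTwo J))) _ _ _
        (continuous_weakStar_inner _ _) (continuous_weakStar_inner _ _)
    have hle : Submodule.span ℂ {S | ∃ a ∈ (A : Set (H →L[ℂ] H)), ∃ y ∈ matrixAlgebra J,
        S = opTensor a y} ≤ C := by
      rw [Submodule.span_le]
      rintro _ ⟨a, ha, y, -, rfl⟩ ξ η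
      rw [ContinuousLinearMap.adjoint_inner_left]
      congr 1
      have : (opTensor a y) ∘L (opTensor x 1) = (opTensor x 1) ∘L (opTensor a y) :=
        hι.clm_ext fun j h => by
          have hax : a (x h) = x (a h) := congrArg (fun S : H →L[ℂ] H => S h)
            (VonNeumannAlgebra.mem_commutant_iff.1 hx a ha)
          rw [ContinuousLinearMap.comp_apply, ContinuousLinearMap.comp_apply,
            opTensor_one_tensorSingle, tensorSingle_apply, tensorSingle_apply,
            opTensor_tmul, opTensor_tmul, opTensor_tmul, hax, one_apply_eq_self]
      exact congrArg (fun S : HilbertTensor H (EllTwo J) →L[ℂ] HilbertTensor H (EllTwo J) => S η)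
        this
    have hTC : T ∈ C := @closure_minimal _ (weakStarTopology _) _ _ hle hC T hT
    refine ext_inner_left ℂ fun ξ => ?_
    rw [hTC ξ z, ContinuousLinearMap.adjoint_inner_left]
  · intro hT
    refine @mem_closure_of_tendsto _ (weakStarTopology _) _ _ _ _ _ _
      (tendsto_weakStar_compression (hilbertSumProj (tensorSingle H))
        hι.norm_hilbertSumProj_le (inner_hilbertSumProj _) hι.tendsto_hilbertSumProj T)
      (Eventually.of_forall fun s => ?_)
    -- The matrix entries of T commute with A' because the embeddings intertwine x with x ⊗ 1. Each
    -- finite compression of T is then the finite sum of the aᵢⱼ ⊗ Eᵢⱼ, and these compressions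
    -- converge to T.
    let a : J → J → H →L[ℂ] H := fun i j =>
      ((tensorSingle H i).toContinuousLinearMap†) ∘L T ∘L (tensorSingle H j).toContinuousLinearMap
    let E : J → J → EllTwo J →L[ℂ] EllTwo J := fun i j =>
      InnerProductSpace.rankOne ℂ (lp.single 2 i (1 : ℂ)) (lp.single 2 j (1 : ℂ))
    have ha : ∀ i j, a i j ∈ A := fun i j =>
      VonNeumannAlgebra.mem_of_forall_commutant fun x hx h => by
        change x (((tensorSingle H i).toContinuousLinearMap†) (T (tensorSingle H j h))) =
          ((tensorSingle H i).toContinuousLinearMap†) (T (tensorSingle H j (x h)))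
        rw [← opTensor_one_tensorSingle, hT x hx]
        generalize T (tensorSingle H j h) = z
        have : x ∘L ((tensorSingle H i).toContinuousLinearMap†) =
            ((tensorSingle H i).toContinuousLinearMap†) ∘L opTensor x 1 :=
          hι.clm_ext fun k h => by
            rw [ContinuousLinearMap.comp_apply, ContinuousLinearMap.comp_apply,
              opTensor_one_tensorSingle]
            by_cases hik : i = k
            · subst hik
              rw [IsHilbertSum.adjoint_apply_apply_self, IsHilbertSum.adjoint_apply_apply_self]
            · rw [hι.adjoint_apply_apply_of_ne hik, hι.adjoint_apply_apply_of_ne hik, map_zero]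
        exact congrArg (fun S : HilbertTensor H (EllTwo J) →L[ℂ] H => S z) this
    have hE : ∀ i j, opTensor (a i j) (E i j) = (tensorSingle H i).toContinuousLinearMap ∘L a i j ∘L
        ((tensorSingle H j).toContinuousLinearMap†) := fun i j =>
      hι.clm_ext fun k h => by
        rw [ContinuousLinearMap.comp_apply, ContinuousLinearMap.comp_apply]
        nth_rw 1 [tensorSingle_apply]
        rw [opTensor_tmul]
        change ((a i j h ⊗ₜ[ℂ] (inner ℂ (lp.single 2 j (1 : ℂ) : EllTwo J) (lp.single 2 k (1 : ℂ)) •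
          (lp.single 2 i (1 : ℂ) : EllTwo J)) : H ⊗[ℂ] EllTwo J) : HilbertTensor H (EllTwo J)) = _
        rw [lp.inner_single_left]
        by_cases hjk : j = k
        · subst hjk
          rw [IsHilbertSum.adjoint_apply_apply_self]
          simp [tensorSingle_apply]
        · rw [hι.adjoint_apply_apply_of_ne hjk, lp.single_apply_ne _ _ _ hjk]
          simp
    have hsum : hilbertSumProj (tensorSingle H) s ∘L T ∘L hilbertSumProj (tensorSingle H) s =
        ∑ i ∈ s, ∑ j ∈ s, opTensor (a i j) (E i j) := by
      refine ContinuousLinearMap.ext fun z => ?_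
      simp only [hE, sum_apply, ContinuousLinearMap.comp_apply, hilbertSumProj_apply, map_sum, a]
      exact Finset.sum_comm
    rw [hsum]
    exact Submodule.sum_mem _ fun i _ => Submodule.sum_mem _ fun j _ =>
      Submodule.subset_span ⟨a i j, ha i j, E i j, trivial, rfl⟩

end Commutant

/-! ### Unitary equivalence of amplifications -/

/-- The amplification is compatible with adjoints. -/
theorem adjoint_opTensor_one {H : Type*} [NormedAddCommGroup H] [InnerProductSpace ℂ H]
    [CompleteSpace H] {J : Type*} (x : H →L[ℂ] H) :
    (opTensor x (1 : EllTwo J →L[ℂ] EllTwo J))† = opTensor (x†) 1 := by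
  have hι := isHilbertSum_tensorSingle (H := H) (J := J)
  refine hι.clm_ext fun j h => ?_
  rw [opTensor_one_tensorSingle]
  have h1 : innerSL ℂ ((opTensor x (1 : EllTwo J →L[ℂ] EllTwo J)†) (tensorSingle H j h)) =
      innerSL ℂ (tensorSingle H j ((x†) h)) := hι.clm_ext fun k h' => by
    rw [innerSL_apply_apply, innerSL_apply_apply, ContinuousLinearMap.adjoint_inner_left,
      opTensor_one_tensorSingle]
    by_cases hjk : j = k
    · subst hjk
      rw [LinearIsometry.inner_map_map, LinearIsometry.inner_map_map,
        ContinuousLinearMap.adjoint_inner_left]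
    · exact (hι.OrthogonalFamily hjk _ _).trans (hι.OrthogonalFamily hjk _ _).symm
  refine ext_inner_right ℂ fun z => ?_
  exact congrArg (fun S : HilbertTensor H (EllTwo J) →L[ℂ] ℂ => S z) h1

namespace VonNeumannAlgebra

variable {H : Type u} [NormedAddCommGroup H] [InnerProductSpace ℂ H] [CompleteSpace H]
  {K : Type v} [NormedAddCommGroup K] [InnerProductSpace ℂ K] [CompleteSpace K]

/-- An amplification of one of two isomorphic von Neumann algebras embeds isometrically into a
sufficiently large amplification of the other one. -/
theorem exists_isometric_intertwiner {M : VonNeumannAlgebra H} {N : VonNeumannAlgebra K}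
    (σ : M.toStarSubalgebra ≃⋆ₐ[ℂ] N.toStarSubalgebra) {J : Type*}
    {c : ℕ × (K →L[ℂ] H) → J → J} (hc : Function.Injective2 c) :
    ∃ S : HilbertTensor K (EllTwo J) →ₗᵢ[ℂ] HilbertTensor H (EllTwo J),
      ∀ (x : M.toStarSubalgebra) z,
        S (opTensor (σ x : K →L[ℂ] K) 1 z) = opTensor (x : H →L[ℂ] H) 1 (S z) := by
  obtain ⟨T, hT, hTs⟩ := exists_family_intertwines σ
  obtain ⟨S, hS⟩ := exists_isometry_of_resolution T hTs hc
    (isHilbertSum_tensorSingle (H := H) (J := J)) (isHilbertSum_tensorSingle (H := K) (J := J))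
  refine ⟨S, fun x z => ?_⟩
  have : S.toContinuousLinearMap ∘L opTensor (σ x : K →L[ℂ] K) 1 =
      opTensor (x : H →L[ℂ] H) 1 ∘L S.toContinuousLinearMap :=
    isHilbertSum_tensorSingle.clm_ext fun j k => by
      rw [ContinuousLinearMap.comp_apply, ContinuousLinearMap.comp_apply,
        opTensor_one_tensorSingle]
      have h1 := (hS j k).mapL (opTensor (x : H →L[ℂ] H) 1)
      simp only [opTensor_one_tensorSingle, ← hT _ x] at h1
      exact (hS j _).unique h1
  exact congrArg (fun R : HilbertTensor K (EllTwo J) →L[ℂ] HilbertTensor H (EllTwo J) => R z) this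

/-- Isomorphic von Neumann algebras have unitarily equivalent amplifications. -/
theorem exists_unitary_amplification {M : VonNeumannAlgebra H} {N : VonNeumannAlgebra K}
    (σ : M.toStarSubalgebra ≃⋆ₐ[ℂ] N.toStarSubalgebra) :
    ∃ J : Type (max u v), Nonempty J ∧
      ∃ U : HilbertTensor H (EllTwo J) ≃ₗᵢ[ℂ] HilbertTensor K (EllTwo J),
        ∀ (x : M.toStarSubalgebra) z,
          U (opTensor (x : H →L[ℂ] H) 1 z) = opTensor (σ x : K →L[ℂ] K) 1 (U z) := by
  -- Prepending a letter to a list is jointly injective, so J absorbs both index sets at once; the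
  -- empty list makes it nonempty.
  let J : Type (max u v) := List ((ℕ × (K →L[ℂ] H)) ⊕ (ℕ × (H →L[ℂ] K)))
  obtain ⟨W, hW⟩ := exists_isometric_intertwiner σ (J := J) (c := fun f j => Sum.inl f :: j)
    fun _ _ _ _ h => ⟨Sum.inl.inj (List.cons.inj h).1, (List.cons.inj h).2⟩
  obtain ⟨V, hV⟩ := exists_isometric_intertwiner σ.symm (J := J) (c := fun f j => Sum.inr f :: j)
    fun _ _ _ _ h => ⟨Sum.inr.inj (List.cons.inj h).1, (List.cons.inj h).2⟩
  obtain ⟨U, hU⟩ := exists_unitary_of_isometric_intertwiners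
    (Set.range fun x : M.toStarSubalgebra =>
      (opTensor (x : H →L[ℂ] H) (1 : EllTwo J →L[ℂ] EllTwo J),
        opTensor (σ x : K →L[ℂ] K) (1 : EllTwo J →L[ℂ] EllTwo J)))
    (by
      rintro _ ⟨x, rfl⟩
      refine ⟨star x, ?_⟩
      simp only [adjoint_opTensor_one, map_star]
      rfl)
    V W
    (by
      rintro _ ⟨x, rfl⟩ z
      simpa using hV (σ x) z)
    (by
      rintro _ ⟨x, rfl⟩ z
      exact hW x z)
  exact ⟨J, ⟨[]⟩, U, fun x z => hU _ ⟨x, rfl⟩ z⟩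

end VonNeumannAlgebra

theorem mainTheorem12 {H : Type u} {K : Type v}
    [NormedAddCommGroup H] [InnerProductSpace ℂ H] [CompleteSpace H]
    [NormedAddCommGroup K] [InnerProductSpace ℂ K] [CompleteSpace K]
    (A : VonNeumannAlgebra H) (B : VonNeumannAlgebra K)
    (hAB : Nonempty (A.commutant.toStarSubalgebra ≃⋆ₐ[ℂ] B.commutant.toStarSubalgebra)) :
    ∃ J : Type (max u v), Nonempty J ∧
      UnitarilyEquivalent
        (normalSpatialTensor (A : Set (H →L[ℂ] H)) (matrixAlgebra J))
        (normalSpatialTensor (B : Set (K →L[ℂ] K)) (matrixAlgebra J)) := by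
  obtain ⟨σ⟩ := hAB
  obtain ⟨J, hJ, U, hU⟩ := VonNeumannAlgebra.exists_unitary_amplification σ
  have hU' : ∀ (x : A.commutant.toStarSubalgebra) z,
      U.symm (opTensor (σ x : K →L[ℂ] K) 1 z) = opTensor (x : H →L[ℂ] H) 1 (U.symm z) :=
    fun x z => by rw [LinearIsometryEquiv.symm_apply_eq, hU, LinearIsometryEquiv.apply_symm_apply]
  refine ⟨J, hJ, U, Set.ext fun T => ?_⟩
  -- Both algebras are now commutants of amplifications that U conjugates into each other, so U
  -- conjugates the commutants too.
  rw [mem_normalSpatialTensor_matrixAlgebra_iff]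
  constructor
  · intro hT
    refine ⟨(U.symm : HilbertTensor K (EllTwo J) →L[ℂ] HilbertTensor H (EllTwo J)) ∘L T ∘L
      (U : HilbertTensor H (EllTwo J) →L[ℂ] HilbertTensor K (EllTwo J)), ?_, ?_⟩
    · rw [mem_normalSpatialTensor_matrixAlgebra_iff]
      intro x hx z
      change U.symm (T (U (opTensor x 1 z))) = opTensor x 1 (U.symm (T (U z)))
      rw [hU ⟨x, hx⟩, hT _ (σ ⟨x, hx⟩).2, hU' ⟨x, hx⟩]
    · refine ContinuousLinearMap.ext fun z => ?_
      change U (U.symm (T (U (U.symm z)))) = T z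
      rw [LinearIsometryEquiv.apply_symm_apply, LinearIsometryEquiv.apply_symm_apply]
  · rintro ⟨S, hS, rfl⟩ y hy z
    rw [mem_normalSpatialTensor_matrixAlgebra_iff] at hS
    obtain ⟨x, hx⟩ := (EquivLike.surjective σ) ⟨y, hy⟩
    have hxy : y = σ x := (congrArg Subtype.val hx).symm
    change U (S (U.symm (opTensor y 1 z))) = opTensor y 1 (U (S (U.symm z)))
    rw [hxy, hU', hS _ x.2, hU]
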